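/- Let $\lambda\ge 0$ and $R\ge 0$. There is $s_0>0$, depending only on $\lambda$ and $R$, such that the following holds for every dimension $d$, all $x^*,x_0\in\mathbb{R}^d$ with $\|x_0-x^*\|\le R$ (Euclidean norm) and every step size $0<s\le s_0$. Let $g(x)=\frac{\lambda}{4}\|x-x^*\|^4$, and let $(x_k)_{k\ge 0}$ be the iterates of Whiplash gradient descent for $g$ started at $x_0$: $$x_1=x_0-s\nabla g(x_0),\qquad x_{k+1}=x_k+\alpha_k z_k-s\nabla g(x_k)\quad(k\ge 1),$$ where $z_k=x_k-x_{k-1}$ and $\alpha_k=1-\sqrt{s}-ks\|z_k\|^2$. Then $$\|x_k-x^*\|=\mathcal{O}\left(\frac{1}{\sqrt[3]{1-\lambda/k}}\right)\qquad(k\to\infty,\ k>\lambda),$$ and, if $\lambda>0$, the sequence $\|x_k-x^*\|$ converges to $0$ as $k\to\infty$. -/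

import Mathlib

open Filter Topology Asymptotics

/-- The iterates `x_k` of the Whiplash gradient descent method with step size `s`, started at `x₀`:
`x_1 = x_0 - s ∇f(x_0)` and, for `k ≥ 1`, with `z_k = x_k - x_{k-1}` and
`α_k = 1 - √s - k s ‖z_k‖²`, `x_{k+1} = x_k + α_k z_k - s ∇f(x_k)`. -/
noncomputable def whiplash {d : ℕ} (f : EuclideanSpace ℝ (Fin d) → ℝ) (s : ℝ)
    (x₀ : EuclideanSpace ℝ (Fin d)) : ℕ → EuclideanSpace ℝ (Fin d)
  | 0 => x₀
  | 1 => x₀ - s • gradient f x₀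
  | k + 2 =>
    let x := whiplash f s x₀ (k + 1)
    let z := x - whiplash f s x₀ k
    let α := 1 - √s - ((k + 1 : ℕ) : ℝ) * s * ‖z‖ ^ 2
    x + α • z - s • gradient f x

/-- The quartic cost `x ↦ (lam / 4) ‖x - x*‖⁴`. -/
noncomputable def quarticCost {d : ℕ} (lam : ℝ) (xstar : EuclideanSpace ℝ (Fin d)) :
    EuclideanSpace ℝ (Fin d) → ℝ :=
  fun x => (1 / 4) * lam * ‖x - xstar‖ ^ 4

/-! With h = √s, y = x - x* and v = z/h, the method is a semi-implicit Euler scheme for y'' + c y' +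
λ‖y‖²y = 0, with c = 1 + k h³‖v‖². While 1 ≤ c ≤ 2 and the state stays bounded, adding a small
multiple of ‖y‖²⟪y, v⟫ to the energy gives W losing at least a multiple of h(‖v‖² + ‖y‖⁶), hence of
hW², per step (`exists_quarticLyapunov_step_le`). So W ≤ 1/(D + khκ) by `sub_mul_sq_le_inv_add`.
This decay in turn keeps k h³‖v‖² ≤ 1, which closes the induction in
`exists_whiplash_quarticCost_bound`. The stated comparison function tends to 1, so boundedness
suffices for the rate; for λ = 0 the iterates are constant. -/

/-- The polynomial Lyapunov function of the damped quartic oscillator, in terms of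
`a = ‖y‖²`, `b = ⟪y, v⟫`, `w = ‖v‖²`. -/
noncomputable def quarticLyapunov (lam δ a b w : ℝ) : ℝ :=
  w / 2 + lam / 4 * a ^ 2 + δ * (a * b)

/-! ### Scalar Cauchy–Schwarz and the size of the Lyapunov function -/

/-- This is ‖s y - t v‖² ≥ 0, with Cauchy–Schwarz as the only trace of the vectors. -/
theorem two_mul_mul_le_of_sq_le_mul {a b w : ℝ} (ha : 0 ≤ a) (hw : 0 ≤ w) (hb : b ^ 2 ≤ a * w)
    (s t : ℝ) : 2 * s * t * b ≤ s ^ 2 * a + t ^ 2 * w := by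
  apply le_of_sq_le_sq _ (by positivity)
  have h1 : (2 * s * t * b) ^ 2 ≤ 4 * (s * t) ^ 2 * (a * w) := by
    have := mul_le_mul_of_nonneg_left hb (by positivity : 0 ≤ 4 * (s * t) ^ 2)
    linarith
  nlinarith [sq_nonneg (s ^ 2 * a - t ^ 2 * w)]

theorem abs_mul_le_of_sq_le_mul {a b w : ℝ} (ha : 0 ≤ a) (hw : 0 ≤ w) (hb : b ^ 2 ≤ a * w)
    {η : ℝ} (hη : 0 < η) : 2 * |a * b| ≤ η * a ^ 3 + w / η := by
  have hs : √η ^ 2 = η := Real.sq_sqrt hη.le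
  have hne : √η ≠ 0 := (Real.sqrt_pos.2 hη).ne'
  have h1 := two_mul_mul_le_of_sq_le_mul ha hw hb (√η * a) (1 / √η)
  have h2 := two_mul_mul_le_of_sq_le_mul ha hw hb (-(√η * a)) (1 / √η)
  have e1 : 2 * (√η * a) * (1 / √η) * b = 2 * (a * b) := by field_simp
  have e2 : 2 * (-(√η * a)) * (1 / √η) * b = -(2 * (a * b)) := by field_simp
  have e3 : (√η * a) ^ 2 * a + (1 / √η) ^ 2 * w = η * a ^ 3 + w / η := by
    rw [mul_pow, div_pow, hs]; ring
  rw [e1, e3] at h1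
  rw [e2, neg_sq, e3] at h2
  rcases abs_cases (a * b) with h | h <;> rw [h.1] <;> linarith

theorem quarticLyapunov_bounds {lam δ A a b w : ℝ} (hδ : 0 < δ)
    (hδA : δ ^ 2 * A ≤ lam / 8) (ha : 0 ≤ a) (hw : 0 ≤ w) (hb : b ^ 2 ≤ a * w) (haA : a ≤ A) :
    (w / 2 + lam / 4 * a ^ 2) / 2 ≤ quarticLyapunov lam δ a b w ∧
      quarticLyapunov lam δ a b w ≤ 3 / 2 * (w / 2 + lam / 4 * a ^ 2) := by
  -- This η bounds the cross term by exactly half the energy.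
  have h := abs_mul_le_of_sq_le_mul ha hw hb (η := 2 * δ) (by positivity)
  have h1 : δ * |a * b| ≤ δ ^ 2 * a ^ 3 + w / 4 := by
    have := mul_le_mul_of_nonneg_left h hδ.le
    have e : δ * (2 * δ * a ^ 3 + w / (2 * δ)) = 2 * δ ^ 2 * a ^ 3 + w / 2 := by field_simp
    rw [e] at this
    linarith
  have h2 : δ ^ 2 * a ^ 3 ≤ lam / 8 * a ^ 2 := by
    calc δ ^ 2 * a ^ 3 = δ ^ 2 * a * a ^ 2 := by ring
      _ ≤ δ ^ 2 * A * a ^ 2 := by gcongr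
      _ ≤ _ := by gcongr
  have h3 : δ * (a * b) ≤ δ * |a * b| := by gcongr; exact le_abs_self _
  have h4 : -(δ * |a * b|) ≤ δ * (a * b) := by
    rw [← mul_neg]; gcongr; exact neg_abs_le _
  unfold quarticLyapunov
  constructor <;> linarith

/-! ### One step of the damped iteration -/

theorem sq_norm_step_le {lam h p a b w wp : ℝ} (hp : 0 ≤ p) (hp1 : p ≤ 1)
    (ha : 0 ≤ a) (hw : 0 ≤ w) (hb : b ^ 2 ≤ a * w)
    (hwp : wp = p ^ 2 * w - 2 * p * (h * lam) * (a * b) + h ^ 2 * lam ^ 2 * a ^ 3) :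
    wp ≤ 2 * w + 2 * h ^ 2 * lam ^ 2 * a ^ 3 := by
  have h1 := two_mul_mul_le_of_sq_le_mul ha hw hb (-(h * lam * a)) p
  have h2 : p ^ 2 * w ≤ 1 * w := by
    gcongr; exact pow_le_one₀ hp hp1
  rw [hwp]; nlinarith

/-- The energy `w / 2 + lam / 4 * a ^ 2` dissipates at rate `w`, up to second order in `h`. -/
theorem energy_step_le {lam h c a b w wp m A K Q : ℝ} (hlam : 0 < lam) (hh : 0 < h)
    (hh2 : h ≤ 1 / 2) (hc1 : 1 ≤ c) (hc2 : c ≤ 2) (ha : 0 ≤ a) (hw : 0 ≤ w)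
    (haA : a ≤ A) (hwp0 : 0 ≤ wp) (hwpQ : wp ≤ Q) (hwpK : wp ≤ K * (w + a ^ 3))
    (hmw : m ^ 2 ≤ a * wp) (hm : m = (1 - h * c) * b - h * lam * a ^ 2)
    (hwp : wp = (1 - h * c) ^ 2 * w - 2 * (1 - h * c) * (h * lam) * (a * b)
      + h ^ 2 * lam ^ 2 * a ^ 3) :
    wp / 2 + lam / 4 * (a + 2 * h * m + h ^ 2 * wp) ^ 2 ≤
      w / 2 + lam / 4 * a ^ 2 - h / 2 * w
        + h ^ 2 * (lam / 4 * (10 * A + 2 * Q) * K * (w + a ^ 3)) := by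
  have hA : 0 ≤ A := ha.trans haA
  have hQ : 0 ≤ Q := hwp0.trans hwpQ
  have e : wp / 2 + lam / 4 * (a + 2 * h * m + h ^ 2 * wp) ^ 2 =
      w / 2 + lam / 4 * a ^ 2 + (-(2 * h * c) + h ^ 2 * c ^ 2) / 2 * w
        - h ^ 2 * lam ^ 2 * a ^ 3 / 2
        + lam / 4 * (2 * h ^ 2 * (a * wp) + (2 * h * m + h ^ 2 * wp) ^ 2) := by
    have e1 : lam / 4 * (a + 2 * h * m + h ^ 2 * wp) ^ 2 = lam / 4 * a ^ 2 + lam * h * a * m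
        + lam / 4 * (2 * h ^ 2 * (a * wp) + (2 * h * m + h ^ 2 * wp) ^ 2) := by ring
    -- Since position moves with the new velocity, the first-order terms in `a * b` cancel.
    have e2 : wp / 2 + lam * h * a * m =
        w / 2 + (-(2 * h * c) + h ^ 2 * c ^ 2) / 2 * w - h ^ 2 * lam ^ 2 * a ^ 3 / 2 := by
      rw [hm, hwp]; ring
    linarith
  have hhc : h * c ≤ 1 := by nlinarith
  have h1 : (-(2 * h * c) + h ^ 2 * c ^ 2) / 2 * w ≤ -(h / 2) * w := by
    gcongr
    nlinarith [mul_nonneg hh.le (by linarith : (0 : ℝ) ≤ c)]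
  have h2 : a * wp ≤ A * wp := by gcongr
  have h3 : (2 * h * m + h ^ 2 * wp) ^ 2 ≤ h ^ 2 * (8 * A + 2 * Q) * wp := by
    have t1 : (2 * h * m + h ^ 2 * wp) ^ 2 ≤ 8 * h ^ 2 * m ^ 2 + 2 * h ^ 4 * wp ^ 2 := by
      nlinarith [sq_nonneg (2 * h * m - h ^ 2 * wp)]
    have t2 : 8 * h ^ 2 * m ^ 2 ≤ 8 * h ^ 2 * (A * wp) := by gcongr; linarith
    have t3 : 2 * h ^ 4 * wp ^ 2 ≤ 2 * h ^ 2 * (Q * wp) := by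
      calc 2 * h ^ 4 * wp ^ 2 = 2 * h ^ 2 * (h ^ 2 * (wp * wp)) := by ring
        _ ≤ 2 * h ^ 2 * (1 * (Q * wp)) := by
          gcongr
          exact pow_le_one₀ hh.le (by linarith)
        _ = _ := by ring
    linarith
  have h4 : lam / 4 * (2 * h ^ 2 * (a * wp) + (2 * h * m + h ^ 2 * wp) ^ 2) ≤
      h ^ 2 * (lam / 4 * (10 * A + 2 * Q) * K * (w + a ^ 3)) := by
    calc _ ≤ lam / 4 * (2 * h ^ 2 * (A * wp) + h ^ 2 * (8 * A + 2 * Q) * wp) := by gcongr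
      _ = h ^ 2 * (lam / 4 * (10 * A + 2 * Q) * wp) := by ring
      _ ≤ h ^ 2 * (lam / 4 * (10 * A + 2 * Q) * (K * (w + a ^ 3))) := by gcongr
      _ = _ := by ring
  have h5 : 0 ≤ h ^ 2 * lam ^ 2 * a ^ 3 / 2 := by positivity
  linarith

/-- The cross term `a * b` dissipates at rate `a ^ 3`, up to `w` and second order in `h`. -/
theorem cross_step_le {lam h c a b w wp m A K Q : ℝ} (hlam : 0 < lam) (hh : 0 < h)
    (hh2 : h ≤ 1 / 2) (hc1 : 1 ≤ c) (hc2 : c ≤ 2) (ha : 0 ≤ a) (hw : 0 ≤ w)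
    (hb : b ^ 2 ≤ a * w)
    (haA : a ≤ A) (hwp0 : 0 ≤ wp) (hwpQ : wp ≤ Q) (hwpK : wp ≤ K * (w + a ^ 3))
    (hwp2 : wp ≤ 2 * w + 2 * h ^ 2 * lam ^ 2 * a ^ 3)
    (hmw : m ^ 2 ≤ a * wp) (hm : m = (1 - h * c) * b - h * lam * a ^ 2) :
    (a + 2 * h * m + h ^ 2 * wp) * (m + h * wp) ≤
      a * b + h * (-(lam / 2) * a ^ 3 + (2 / lam + 6 * A) * w)
        + h ^ 2 * ((6 * A * lam ^ 2 + 3 * (1 + A * Q) * K + Q * K) * (w + a ^ 3)) := by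
  have hA : 0 ≤ A := ha.trans haA
  have hQ : 0 ≤ Q := hwp0.trans hwpQ
  have e : (a + 2 * h * m + h ^ 2 * wp) * (m + h * wp) =
      a * b - h * c * (a * b) - h * lam * a ^ 3 + h * (a * wp + 2 * m ^ 2)
        + 3 * h ^ 2 * m * wp + h ^ 3 * wp ^ 2 := by
    have e1 : a * m = a * b - h * c * (a * b) - h * lam * a ^ 3 := by rw [hm]; ring
    linear_combination e1
  have hq : 0 ≤ w + a ^ 3 := by positivity
  have hawp : a * wp ≤ A * wp := by gcongr
  have h1 : -(h * c * (a * b)) ≤ h * (lam / 2 * a ^ 3 + 2 / lam * w) := by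
    -- This η spends half of the `lam * a ^ 3` dissipation.
    have t := abs_mul_le_of_sq_le_mul ha hw hb (η := lam / 2) (by positivity)
    have t1 : -(c * (a * b)) ≤ 2 * |a * b| := by
      have : |c * (a * b)| ≤ 2 * |a * b| := by
        rw [abs_mul, abs_of_nonneg (by linarith : (0 : ℝ) ≤ c)]; gcongr
      linarith [neg_abs_le (c * (a * b))]
    have t2 : w / (lam / 2) = 2 / lam * w := by field_simp
    calc -(h * c * (a * b)) = h * (-(c * (a * b))) := by ring
      _ ≤ _ := by gcongr; linarith
  have h2 : h * (a * wp + 2 * m ^ 2) ≤ h * (6 * A * w) + h ^ 2 * (6 * A * lam ^ 2 * (w + a ^ 3)) := by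
    have t : h * (h ^ 2 * (6 * A * lam ^ 2 * a ^ 3)) ≤ 1 * (h ^ 2 * (6 * A * lam ^ 2 * (w + a ^ 3))) := by
      gcongr
      · linarith
      · linarith
    calc h * (a * wp + 2 * m ^ 2) ≤ h * (3 * A * wp) := by gcongr; linarith
      _ ≤ h * (3 * A * (2 * w + 2 * h ^ 2 * lam ^ 2 * a ^ 3)) := by gcongr
      _ ≤ _ := by linarith
  have h3 : 3 * h ^ 2 * m * wp ≤ h ^ 2 * (3 * (1 + A * Q) * K * (w + a ^ 3)) := by
    have t1 : m ≤ 1 + A * Q := by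
      have : A * wp ≤ A * Q := by gcongr
      nlinarith [sq_nonneg (m - 1), sq_nonneg m]
    calc 3 * h ^ 2 * m * wp ≤ 3 * h ^ 2 * (1 + A * Q) * (K * (w + a ^ 3)) := by gcongr
      _ = _ := by ring
  have h4 : h ^ 3 * wp ^ 2 ≤ h ^ 2 * (Q * K * (w + a ^ 3)) := by
    calc h ^ 3 * wp ^ 2 = h ^ 2 * (h * (wp * wp)) := by ring
      _ ≤ h ^ 2 * (1 * (Q * (K * (w + a ^ 3)))) := by
        gcongr
        linarith
      _ = _ := by ring
  rw [e]
  linarith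

/-- On a bounded region the squared energy, of order w² + a⁴, is dominated by the dissipation w +
a³. -/
theorem quarticLyapunov_sq_le {lam δ A B a b w : ℝ} (hlam : 0 < lam) (hδ : 0 < δ)
    (hδA : δ ^ 2 * A ≤ lam / 8) (ha : 0 ≤ a) (hw : 0 ≤ w) (hb : b ^ 2 ≤ a * w) (haA : a ≤ A)
    (hwB : w ≤ B) :
    quarticLyapunov lam δ a b w ^ 2 ≤ (9 / 8 * B + 9 / 32 * lam ^ 2 * A) * (w + a ^ 3) := by
  obtain ⟨hlo, hup⟩ := quarticLyapunov_bounds hδ hδA ha hw hb haA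
  have hA : 0 ≤ A := ha.trans haA
  have hB : 0 ≤ B := hw.trans hwB
  have hE : 0 ≤ w / 2 + lam / 4 * a ^ 2 := by positivity
  have s1 : w * w ≤ B * w := by gcongr
  have s2 : lam ^ 2 * (a ^ 3 * a) ≤ lam ^ 2 * (a ^ 3 * A) := by gcongr
  have s3 : 0 ≤ B * a ^ 3 := by positivity
  have s4 : 0 ≤ lam ^ 2 * A * w := by positivity
  calc quarticLyapunov lam δ a b w ^ 2 ≤ (3 / 2 * (w / 2 + lam / 4 * a ^ 2)) ^ 2 := by
        apply pow_le_pow_left₀ (by linarith) hup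
    _ ≤ 9 / 8 * (w * w) + 9 / 32 * (lam ^ 2 * (a ^ 3 * a)) := by
        have := sq_nonneg (w / 2 - lam / 4 * a ^ 2)
        linarith
    _ ≤ _ := by linarith

theorem quarticLyapunov_le_of_energy_of_cross {lam δ κ h A K₂ K₃ a b w ap bp wp : ℝ}
    (hδ : 0 < δ) (hh : 0 < h) (hw : 0 ≤ w) (ha : 0 ≤ a) (hκ1 : κ ≤ 1 / 8)
    (hκ2 : κ ≤ δ * lam / 4) (hδ1 : δ * (2 / lam + 6 * A) ≤ 1 / 4) (hhκ : h * (K₂ + δ * K₃) ≤ κ)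
    (h1 : wp / 2 + lam / 4 * ap ^ 2 ≤
      w / 2 + lam / 4 * a ^ 2 - h / 2 * w + h ^ 2 * (K₂ * (w + a ^ 3)))
    (h2 : ap * bp ≤ a * b + h * (-(lam / 2) * a ^ 3 + (2 / lam + 6 * A) * w)
        + h ^ 2 * (K₃ * (w + a ^ 3))) :
    quarticLyapunov lam δ ap bp wp ≤ quarticLyapunov lam δ a b w - h * (κ * (w + a ^ 3)) := by
  have h3 := mul_le_mul_of_nonneg_left h2 hδ.le
  have h4 : h * (δ * (2 / lam + 6 * A) * w) ≤ h * (1 / 4 * w) := by gcongr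
  have h5 : h * (h * (K₂ + δ * K₃) * (w + a ^ 3)) ≤ h * (κ * (w + a ^ 3)) := by gcongr
  have h6 : h * (κ * w) ≤ h * (1 / 8 * w) := by gcongr
  have h7 : h * (κ * a ^ 3) ≤ h * (δ * lam / 4 * a ^ 3) := by gcongr
  unfold quarticLyapunov
  generalize 2 / lam + 6 * A = M at *
  linarith

/-- One step of the damped iteration decreases the Lyapunov function, on a bounded region and for
small step sizes. -/
theorem exists_quarticLyapunov_step_le {lam A B : ℝ} (hlam : 0 < lam) (hA : 0 < A) (hB : 0 < B) :
    ∃ δ κ h₀ : ℝ, 0 < δ ∧ 0 < κ ∧ 0 < h₀ ∧ δ ^ 2 * A ≤ lam / 8 ∧ ∀ h c a b w wp m : ℝ,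
      0 < h → h ≤ h₀ → 1 ≤ c → c ≤ 2 → 0 ≤ a → a ≤ A → 0 ≤ w → w ≤ B → b ^ 2 ≤ a * w →
      0 ≤ wp → m ^ 2 ≤ a * wp → m = (1 - h * c) * b - h * lam * a ^ 2 →
      wp = (1 - h * c) ^ 2 * w - 2 * (1 - h * c) * (h * lam) * (a * b)
        + h ^ 2 * lam ^ 2 * a ^ 3 →
      quarticLyapunov lam δ (a + 2 * h * m + h ^ 2 * wp) (m + h * wp) wp ≤
        quarticLyapunov lam δ a b w - h * (κ * quarticLyapunov lam δ a b w ^ 2) := by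
  set K : ℝ := 2 + 2 * lam ^ 2 with hK
  have hK0 : 0 < K := by positivity
  set Q : ℝ := K * (B + A ^ 3) with hQ
  have hQ0 : 0 < Q := by positivity
  set K₂ : ℝ := lam / 4 * (10 * A + 2 * Q) * K with hK₂
  set K₃ : ℝ := 6 * A * lam ^ 2 + 3 * (1 + A * Q) * K + Q * K with hK₃
  have hK₂0 : 0 < K₂ := by positivity
  have hK₃0 : 0 < K₃ := by positivity
  -- The first bound lets the cross term consume at most half of the dissipation `h / 2 * w`; the
  -- second keeps W comparable to the energy.
  set δ : ℝ := min (1 / (4 * (2 / lam + 6 * A))) (√(lam / (8 * A))) with hδ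
  have hδ0 : 0 < δ := by
    rw [hδ, lt_min_iff]
    exact ⟨by positivity, Real.sqrt_pos.2 (by positivity)⟩
  have hδ1 : δ * (2 / lam + 6 * A) ≤ 1 / 4 := by
    have hpos : 0 < 2 / lam + 6 * A := by positivity
    calc δ * (2 / lam + 6 * A) ≤ 1 / (4 * (2 / lam + 6 * A)) * (2 / lam + 6 * A) := by
          gcongr; exact min_le_left _ _
      _ = 1 / 4 := by field_simp
  have hδ2 : δ ^ 2 * A ≤ lam / 8 := by
    calc δ ^ 2 * A ≤ √(lam / (8 * A)) ^ 2 * A := by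
          gcongr; exact min_le_right _ _
      _ = lam / 8 := by rw [Real.sq_sqrt (by positivity)]; field_simp
  -- Half of what remains of each dissipation term; the other half absorbs the `h ^ 2` errors.
  set κ : ℝ := min (1 / 8) (δ * lam / 4) with hκ
  have hκ1 : κ ≤ 1 / 8 := min_le_left _ _
  have hκ2 : κ ≤ δ * lam / 4 := min_le_right _ _
  have hκ0 : 0 < κ := by rw [hκ, lt_min_iff]; exact ⟨by norm_num, by positivity⟩
  set L : ℝ := 9 / 8 * B + 9 / 32 * lam ^ 2 * A with hL
  have hL0 : 0 < L := by positivity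
  refine ⟨δ, κ / L, min (1 / 2) (κ / (K₂ + δ * K₃)), hδ0, by positivity, ?_, hδ2, ?_⟩
  · rw [lt_min_iff]; exact ⟨by norm_num, by positivity⟩
  intro h c a b w wp m hh hh₀ hc1 hc2 ha haA hw hwB hb hwp0 hmw hm hwp
  have hh2 : h ≤ 1 / 2 := hh₀.trans (min_le_left _ _)
  have hhκ : h * (K₂ + δ * K₃) ≤ κ := by
    rw [← le_div_iff₀ (by positivity)]; exact hh₀.trans (min_le_right _ _)
  clear_value δ κ L K₂ K₃
  have hhc0 : 0 ≤ h * c := by positivity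
  have hhc : h * c ≤ 1 := by nlinarith
  have hwp2 : wp ≤ 2 * w + 2 * h ^ 2 * lam ^ 2 * a ^ 3 :=
    sq_norm_step_le (by linarith) (by linarith) ha hw hb hwp
  have hq : 0 ≤ w + a ^ 3 := by positivity
  have hwpK : wp ≤ K * (w + a ^ 3) := by
    have t : h ^ 2 * (2 * lam ^ 2 * a ^ 3) ≤ 1 * (2 * lam ^ 2 * a ^ 3) := by
      gcongr; exact pow_le_one₀ hh.le (by linarith)
    have t' : 0 ≤ lam ^ 2 * w := by positivity
    have t'' : 0 ≤ a ^ 3 := by positivity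
    rw [hK]; linarith
  have hwpQ : wp ≤ Q := hwpK.trans (by rw [hQ]; gcongr)
  have h1 := energy_step_le hlam hh hh2 hc1 hc2 ha hw haA hwp0 hwpQ hwpK hmw hm hwp
  have h2 := cross_step_le hlam hh hh2 hc1 hc2 ha hw hb haA hwp0 hwpQ hwpK hwp2 hmw hm
  rw [← hK₂] at h1
  rw [← hK₃] at h2
  have hdec := quarticLyapunov_le_of_energy_of_cross hδ0 hh hw ha hκ1 hκ2 hδ1 hhκ h1 h2
  have hWq : quarticLyapunov lam δ a b w ^ 2 ≤ L * (w + a ^ 3) :=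
    hL ▸ quarticLyapunov_sq_le hlam hδ0 hδ2 ha hw hb haA hwB
  have hfin : κ / L * quarticLyapunov lam δ a b w ^ 2 ≤ κ * (w + a ^ 3) := by
    calc _ ≤ κ / L * (L * (w + a ^ 3)) := by gcongr
      _ = _ := by field_simp
  have := mul_le_mul_of_nonneg_left hfin hh.le
  linarith

/-- The map x - θx² increases up to 1/(2θ) ≥ 1/T, so x = 1/T is the worst case; then (T - θ)(T + θ)
≤ T². -/
theorem sub_mul_sq_le_inv_add {x θ T : ℝ} (hθ : 0 ≤ θ) (hT : 0 < T) (hθT : 2 * θ ≤ T)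
    (hx : x ≤ T⁻¹) : x - θ * x ^ 2 ≤ (T + θ)⁻¹ := by
  have h1 : x - θ * x ^ 2 ≤ T⁻¹ - θ * T⁻¹ ^ 2 := by
    have h2 : θ * (x + T⁻¹) ≤ 1 := by
      have : θ * (2 * T⁻¹) ≤ 1 := by
        rw [← mul_assoc, ← div_eq_mul_inv, div_le_one hT]; linarith
      have : θ * (x + T⁻¹) ≤ θ * (2 * T⁻¹) := by gcongr; linarith
      linarith
    nlinarith
  refine h1.trans ?_
  have e : T⁻¹ - θ * T⁻¹ ^ 2 = (T - θ) / T ^ 2 := by field_simp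
  rw [e, inv_eq_one_div, div_le_div_iff₀ (by positivity) (by positivity)]
  nlinarith [sq_nonneg θ]

/-! ### The iteration in rescaled variables -/

theorem gradient_quarticCost {d : ℕ} (lam : ℝ) (xstar x : EuclideanSpace ℝ (Fin d)) :
    gradient (quarticCost lam xstar) x = (lam * ‖x - xstar‖ ^ 2) • (x - xstar) := by
  apply HasGradientAt.gradient
  rw [hasGradientAt_iff_hasFDerivAt]
  have h1 : HasFDerivAt (fun y => ‖y - xstar‖ ^ 2) (2 • innerSL ℝ (x - xstar)) x := by
    simpa using ((hasFDerivAt_id x).sub_const xstar).norm_sq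
  have h2 := (h1.pow 2).const_mul (1 / 4 * lam)
  have e : quarticCost lam xstar = fun y => 1 / 4 * lam * (‖y - xstar‖ ^ 2) ^ 2 := by
    funext y; simp only [quarticCost]; ring
  rw [e]
  refine h2.congr_fderiv ?_
  ext v
  simp
  ring

/-- The rescaled velocities `z_k / √s` of the Whiplash iteration, with initial value `0`. -/
noncomputable def whiplashVelocity {d : ℕ} (f : EuclideanSpace ℝ (Fin d) → ℝ) (s : ℝ)
    (x₀ : EuclideanSpace ℝ (Fin d)) : ℕ → EuclideanSpace ℝ (Fin d)
  | 0 => 0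
  | k + 1 => (√s)⁻¹ • (whiplash f s x₀ (k + 1) - whiplash f s x₀ k)

theorem whiplash_succ {d : ℕ} (f : EuclideanSpace ℝ (Fin d) → ℝ) {s : ℝ} (hs : 0 < s)
    (x₀ : EuclideanSpace ℝ (Fin d)) (k : ℕ) :
    whiplash f s x₀ (k + 1) = whiplash f s x₀ k + √s • whiplashVelocity f s x₀ (k + 1) := by
  have : √s ≠ 0 := (Real.sqrt_pos.2 hs).ne'
  simp [whiplashVelocity, smul_smul, this]

/-- Zero initial velocity lets the plain gradient step at k = 0 obey the same recurrence. -/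
theorem whiplashVelocity_succ {d : ℕ} (f : EuclideanSpace ℝ (Fin d) → ℝ) {s : ℝ} (hs : 0 < s)
    (x₀ : EuclideanSpace ℝ (Fin d)) (k : ℕ) :
    whiplashVelocity f s x₀ (k + 1) =
      (1 - √s * (1 + k * √s ^ 3 * ‖whiplashVelocity f s x₀ k‖ ^ 2)) • whiplashVelocity f s x₀ k
        - √s • gradient f (whiplash f s x₀ k) := by
  have h0 : √s ≠ 0 := (Real.sqrt_pos.2 hs).ne'
  have hsq : s = √s ^ 2 := (Real.sq_sqrt hs.le).symm
  have e0 : (√s)⁻¹ * s = √s := by nth_rewrite 2 [hsq]; field_simp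
  cases k with
  | zero => simp [whiplashVelocity, whiplash, smul_smul, e0]
  | succ k =>
    have hz : whiplash f s x₀ (k + 1) - whiplash f s x₀ k
        = √s • whiplashVelocity f s x₀ (k + 1) := by
      rw [whiplash_succ f hs]; simp
    have hx : whiplash f s x₀ (k + 1 + 1) - whiplash f s x₀ (k + 1) =
        (1 - √s - ((k + 1 : ℕ) : ℝ) * s * ‖√s • whiplashVelocity f s x₀ (k + 1)‖ ^ 2) •
          √s • whiplashVelocity f s x₀ (k + 1) - s • gradient f (whiplash f s x₀ (k + 1)) := by
      rw [← hz]; simp only [whiplash]; abel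
    rw [show whiplashVelocity f s x₀ (k + 1 + 1) = (√s)⁻¹ •
      (whiplash f s x₀ (k + 1 + 1) - whiplash f s x₀ (k + 1)) from rfl, hx, smul_sub, smul_smul,
      smul_smul, smul_smul, e0]
    congr 2
    rw [norm_smul, Real.norm_of_nonneg (Real.sqrt_nonneg s), mul_pow]
    nth_rewrite 3 [hsq]
    field_simp
    ring

/-! ### Bootstrap for the decay -/

/-- Uniform decay along the Whiplash iteration of the quartic cost. -/
theorem exists_whiplash_quarticCost_bound {lam R : ℝ} (hlam : 0 < lam) (hR : 0 < R) :
    ∃ h₀ D κ : ℝ, 0 < h₀ ∧ 0 < D ∧ 0 < κ ∧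
      ∀ (d : ℕ) (xstar x₀ : EuclideanSpace ℝ (Fin d)), ‖x₀ - xstar‖ ≤ R →
        ∀ s : ℝ, 0 < s → √s ≤ h₀ → ∀ k : ℕ,
          ‖whiplash (quarticCost lam xstar) s x₀ k - xstar‖ ^ 4 ≤
            8 / lam * (D + k * (√s * κ))⁻¹ := by
  obtain ⟨δ, κ, h₀, hδ, hκ, hh₀, hδA, hstep⟩ := exists_quarticLyapunov_step_le hlam
    (A := 4 * R ^ 2) (B := 4 * lam * R ^ 4) (by positivity) (by positivity)
  set D : ℝ := (lam / 4 * R ^ 4)⁻¹ with hD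
  have hD0 : 0 < D := by positivity
  set V : ℝ := 2 * (lam * R ^ 4) + 2 * lam ^ 2 * (4 * R ^ 2) ^ 3 with hV
  have hV0 : 0 < V := by positivity
  -- The last three bounds serve, in order, c ≤ 2, the comparison lemma, and ‖y‖² ≤ 4R² at the next
  -- step.
  refine ⟨min (min h₀ (1 / 2)) (min (√(κ / 4)) (min (D / (2 * κ)) (√(R ^ 2 / (2 * V))))), D, κ,
    ?_, hD0, hκ, ?_⟩
  · simp only [lt_min_iff]
    exact ⟨⟨hh₀, by norm_num⟩, Real.sqrt_pos.2 (by positivity), by positivity,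
      Real.sqrt_pos.2 (by positivity)⟩
  intro d xstar x₀ hx₀ s hs hsh
  set h : ℝ := √s with hh
  have hpos : 0 < h := Real.sqrt_pos.2 hs
  simp only [le_min_iff] at hsh
  obtain ⟨⟨hle₀, hhalf⟩, hle₁, hle₂, hle₃⟩ := hsh
  rw [Real.le_sqrt hpos.le (by positivity)] at hle₁ hle₃
  rw [le_div_iff₀ (by positivity)] at hle₂ hle₃
  replace hle₂ : 2 * (h * κ) ≤ D := by linarith
  set y : ℕ → EuclideanSpace ℝ (Fin d) :=
    fun k => whiplash (quarticCost lam xstar) s x₀ k - xstar with hy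
  set v : ℕ → EuclideanSpace ℝ (Fin d) := whiplashVelocity (quarticCost lam xstar) s x₀ with hv
  have hys : ∀ k, y (k + 1) = y k + h • v (k + 1) := by
    intro k; simp only [hy, hv, hh]; rw [whiplash_succ _ hs]; abel
  have hvs : ∀ k : ℕ, v (k + 1) = (1 - h * (1 + k * h ^ 3 * ‖v k‖ ^ 2)) • v k
      - (h * lam * ‖y k‖ ^ 2) • y k := by
    intro k
    simp only [hy, hv, hh]
    rw [whiplashVelocity_succ _ hs, gradient_quarticCost, smul_smul, mul_assoc (√s)]
  have hcs : ∀ k, (inner ℝ (y k) (v k)) ^ 2 ≤ ‖y k‖ ^ 2 * ‖v k‖ ^ 2 := by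
    intro k
    rw [← mul_pow, ← sq_abs]
    gcongr
    exact abs_real_inner_le_norm _ _
  set W : ℕ → ℝ :=
    fun k => quarticLyapunov lam δ (‖y k‖ ^ 2) (inner ℝ (y k) (v k)) (‖v k‖ ^ 2) with hW
  have hT : ∀ k : ℕ, D ≤ D + k * (h * κ) := fun k => by
    have : 0 ≤ k * (h * κ) := by positivity
    linarith
  have hEW : ∀ k : ℕ, ‖y k‖ ^ 2 ≤ 4 * R ^ 2 → W k ≤ (D + k * (h * κ))⁻¹ →
      ‖v k‖ ^ 2 ≤ 4 * (D + k * (h * κ))⁻¹ ∧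
        (‖y k‖ ^ 2) ^ 2 ≤ 8 / lam * (D + k * (h * κ))⁻¹ := by
    intro k hA hWk
    have hlo := (quarticLyapunov_bounds hδ hδA (sq_nonneg ‖y k‖) (sq_nonneg ‖v k‖) (hcs k) hA).1
    have h1 := hlo.trans hWk
    have h2 : 0 ≤ lam / 4 * (‖y k‖ ^ 2) ^ 2 := by positivity
    have h3 : 0 ≤ ‖v k‖ ^ 2 := by positivity
    refine ⟨by linarith, ?_⟩
    rw [div_mul_eq_mul_div, le_div_iff₀ hlam]
    linarith
  have key : ∀ k : ℕ, ‖y k‖ ^ 2 ≤ 4 * R ^ 2 ∧ W k ≤ (D + k * (h * κ))⁻¹ := by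
    intro k
    induction k with
    | zero =>
      have h0 : y 0 = x₀ - xstar := by simp [hy, whiplash]
      have h0v : v 0 = 0 := rfl
      have h1 : ‖y 0‖ ≤ R := h0 ▸ hx₀
      refine ⟨?_, ?_⟩
      · have : ‖y 0‖ ^ 2 ≤ R ^ 2 := by gcongr
        nlinarith
      · simp only [hW, h0v, quarticLyapunov, hD]
        simp only [norm_zero, inner_zero_right, Nat.cast_zero]
        have : lam / 4 * ‖y 0‖ ^ 4 ≤ lam / 4 * R ^ 4 := by gcongr
        simp only [zero_mul, add_zero, inv_inv]
        linarith
    | succ k ih =>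
      obtain ⟨hA, hWk⟩ := ih
      obtain ⟨hw4, ha8⟩ := hEW k hA hWk
      have hTD : (D + k * (h * κ))⁻¹ ≤ lam / 4 * R ^ 4 := by
        rw [← inv_inv (lam / 4 * R ^ 4), ← hD]
        exact inv_anti₀ hD0 (hT k)
      have hTpos : 0 < D + k * (h * κ) := hD0.trans_le (hT k)
      have hwB : ‖v k‖ ^ 2 ≤ lam * R ^ 4 := by linarith
      have haR : ‖y k‖ ^ 2 ≤ 3 / 2 * R ^ 2 := by
        apply le_of_sq_le_sq _ (by positivity)
        have : 8 / lam * (D + k * (h * κ))⁻¹ ≤ 8 / lam * (lam / 4 * R ^ 4) := by gcongr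
        have e : 8 / lam * (lam / 4 * R ^ 4) = 2 * R ^ 4 := by field_simp; norm_num
        have : 0 ≤ R ^ 4 := by positivity
        linarith
      set c : ℝ := 1 + k * h ^ 3 * ‖v k‖ ^ 2 with hc
      have hc1 : 1 ≤ c := by
        have : 0 ≤ k * h ^ 3 * ‖v k‖ ^ 2 := by positivity
        linarith
      have hc2 : c ≤ 2 := by
        have h1 : k * h ^ 3 * ‖v k‖ ^ 2 ≤ k * h ^ 3 * (4 * (D + k * (h * κ))⁻¹) := by gcongr
        -- The 1/k decay of ‖v‖² cancels the growing factor k.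
        have h2 : k * h ^ 3 * (4 * (D + k * (h * κ))⁻¹) ≤ 1 := by
          rw [← mul_assoc, ← div_eq_mul_inv, div_le_one hTpos]
          have : k * h * (4 * h ^ 2) ≤ k * h * κ := by gcongr; linarith only [hle₁]
          linarith only [this, hD0]
        linarith
      have hvk := hvs k
      rw [← hc] at hvk
      have hm : inner ℝ (y k) (v (k + 1)) =
          (1 - h * c) * inner ℝ (y k) (v k) - h * lam * (‖y k‖ ^ 2) ^ 2 := by
        rw [hvk, inner_sub_right, real_inner_smul_right, real_inner_smul_right,
          real_inner_self_eq_norm_sq]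
        ring
      have hwp : ‖v (k + 1)‖ ^ 2 = (1 - h * c) ^ 2 * ‖v k‖ ^ 2
          - 2 * (1 - h * c) * (h * lam) * (‖y k‖ ^ 2 * inner ℝ (y k) (v k))
          + h ^ 2 * lam ^ 2 * (‖y k‖ ^ 2) ^ 3 := by
        rw [hvk, norm_sub_sq_real, norm_smul, norm_smul, mul_pow, mul_pow, Real.norm_eq_abs,
          Real.norm_eq_abs, sq_abs, sq_abs, real_inner_smul_left, real_inner_smul_right,
          real_inner_comm]
        ring
      have hap : ‖y (k + 1)‖ ^ 2 = ‖y k‖ ^ 2 + 2 * h * inner ℝ (y k) (v (k + 1))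
          + h ^ 2 * ‖v (k + 1)‖ ^ 2 := by
        rw [hys k, norm_add_sq_real, real_inner_smul_right, norm_smul, Real.norm_eq_abs, mul_pow,
          sq_abs]
        ring
      have hbp : inner ℝ (y (k + 1)) (v (k + 1)) =
          inner ℝ (y k) (v (k + 1)) + h * ‖v (k + 1)‖ ^ 2 := by
        rw [hys k, inner_add_left, real_inner_smul_left, real_inner_self_eq_norm_sq]
      have hmw : (inner ℝ (y k) (v (k + 1))) ^ 2 ≤ ‖y k‖ ^ 2 * ‖v (k + 1)‖ ^ 2 := by
        rw [← mul_pow, ← sq_abs]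
        gcongr
        exact abs_real_inner_le_norm _ _
      have hR4 : 0 ≤ lam * R ^ 4 := by positivity
      have hdec := hstep h c _ _ _ _ _ hpos hle₀ hc1 hc2 (sq_nonneg ‖y k‖) hA (sq_nonneg ‖v k‖)
        (by linarith only [hwB, hR4]) (hcs k) (sq_nonneg ‖v (k + 1)‖) hmw hm hwp
      rw [← hap, ← hbp] at hdec
      refine ⟨?_, ?_⟩
      · have hhc : h * c ≤ 1 := by
          calc h * c ≤ 1 / 2 * 2 := by gcongr
            _ = 1 := by norm_num
        have hhc0 : 0 ≤ h * c := by positivity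
        have hwp2 := sq_norm_step_le (sub_nonneg.2 hhc) (sub_le_self _ hhc0) (sq_nonneg ‖y k‖)
          (sq_nonneg ‖v k‖) (hcs k) hwp
        have hV' : ‖v (k + 1)‖ ^ 2 ≤ V := by
          have h1 : h ^ 2 * (2 * lam ^ 2 * (‖y k‖ ^ 2) ^ 3)
              ≤ 1 * (2 * lam ^ 2 * (4 * R ^ 2) ^ 3) := by
            gcongr
            exact pow_le_one₀ hpos.le (by linarith only [hhalf])
          rw [hV]
          linarith only [h1, hwp2, hwB]
        -- The lower bound on W needs `a ≤ A` beforehand, so the new position is bounded directly: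
        -- 2(3/2)R² + 2h²V ≤ 4R².
        have h1 := two_mul_mul_le_of_sq_le_mul (sq_nonneg ‖y k‖) (sq_nonneg ‖v (k + 1)‖) hmw 1 h
        have h2 : h ^ 2 * ‖v (k + 1)‖ ^ 2 ≤ h ^ 2 * V := by gcongr
        rw [hap]
        linarith only [h1, h2, haR, hle₃]
      · have := sub_mul_sq_le_inv_add (θ := h * κ) (by positivity) hTpos
          (hle₂.trans (hT k)) hWk
        calc W (k + 1) ≤ W k - h * κ * W k ^ 2 := by
              simp only [hW]; rw [mul_assoc h]; exact hdec
          _ ≤ (D + k * (h * κ) + h * κ)⁻¹ := this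
          _ = _ := by push_cast; ring_nf
  intro k
  obtain ⟨hA, hWk⟩ := key k
  have := (hEW k hA hWk).2
  calc ‖y k‖ ^ 4 = (‖y k‖ ^ 2) ^ 2 := by ring
    _ ≤ _ := this

/-! ### The degenerate case and the conclusion -/

theorem whiplash_quarticCost_zero {d : ℕ} (xstar : EuclideanSpace ℝ (Fin d)) {s : ℝ} (hs : 0 < s)
    (x₀ : EuclideanSpace ℝ (Fin d)) (k : ℕ) : whiplash (quarticCost 0 xstar) s x₀ k = x₀ := by
  have hv : ∀ k, whiplashVelocity (quarticCost 0 xstar) s x₀ k = 0 := by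
    intro k
    induction k with
    | zero => rfl
    | succ k ih => rw [whiplashVelocity_succ _ hs, ih, gradient_quarticCost]; simp
  induction k with
  | zero => simp [whiplash]
  | succ k ih => rw [whiplash_succ _ hs, ih, hv]; simp

theorem isBigO_one_div_one_sub_div_rpow (lam : ℝ) {u : ℕ → ℝ}
    (hu : u =O[atTop] (fun _ => (1 : ℝ))) :
    u =O[atTop] (fun k : ℕ => 1 / (1 - lam / (k : ℝ)) ^ (1 / 3 : ℝ)) := by
  have h1 : Tendsto (fun k : ℕ => 1 - lam / (k : ℝ)) atTop (𝓝 1) := by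
    simpa using (tendsto_const_div_atTop_nhds_zero_nat lam).const_sub 1
  have h2 : Tendsto (fun k : ℕ => 1 / (1 - lam / (k : ℝ)) ^ (1 / 3 : ℝ)) atTop (𝓝 1) := by
    have := (h1.rpow_const (p := (1 / 3 : ℝ)) (Or.inl one_ne_zero)).inv₀ (by simp)
    simpa using this
  exact hu.trans (isBigO_const_left_iff_pos_le_norm one_ne_zero |>.2
    ⟨1 / 2, by norm_num, (h2.norm.eventually (lt_mem_nhds (by norm_num))).mono fun _ h => h.le⟩)

theorem mainTheorem8 (lam : ℝ) (hlam : 0 ≤ lam) (R : ℝ) :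
    ∃ s₀ : ℝ, 0 < s₀ ∧
      ∀ (d : ℕ) (xstar x₀ : EuclideanSpace ℝ (Fin d)), ‖x₀ - xstar‖ ≤ R →
        ∀ s : ℝ, 0 < s → s ≤ s₀ →
          (0 < lam →
            Tendsto (fun k : ℕ => ‖whiplash (quarticCost lam xstar) s x₀ k - xstar‖)
              atTop (𝓝 0)) ∧
          (fun k : ℕ => ‖whiplash (quarticCost lam xstar) s x₀ k - xstar‖) =O[atTop]
            (fun k : ℕ => 1 / (1 - lam / (k : ℝ)) ^ (1 / 3 : ℝ)) := by
  rcases hlam.eq_or_lt with rfl | hpos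
  · refine ⟨1, one_pos, fun d xstar x₀ _ s hs _ => ⟨fun h => absurd h (lt_irrefl _), ?_⟩⟩
    apply isBigO_one_div_one_sub_div_rpow
    simp only [whiplash_quarticCost_zero xstar hs x₀]
    exact isBigO_const_const _ one_ne_zero _
  · obtain ⟨h₀, D, κ, hh₀, hD, hκ, hbound⟩ :=
      -- The bound needs a positive radius.
      exists_whiplash_quarticCost_bound hpos (R := |R| + 1) (by positivity)
    refine ⟨h₀ ^ 2, by positivity, fun d xstar x₀ hx₀ s hs hsle => ?_⟩
    have hb := hbound d xstar x₀ (by linarith [le_abs_self R]) s hs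
      ((Real.sqrt_le_left hh₀.le).2 hsle)
    have hlin : Tendsto (fun k : ℕ => D + (k : ℝ) * (√s * κ)) atTop atTop :=
      tendsto_atTop_add_const_left _ _ (tendsto_natCast_atTop_atTop.atTop_mul_const
        (mul_pos (Real.sqrt_pos.2 hs) hκ))
    have h4 : Tendsto (fun k : ℕ => ‖whiplash (quarticCost lam xstar) s x₀ k - xstar‖ ^ 4)
        atTop (𝓝 0) := by
      refine squeeze_zero (fun k => by positivity) hb ?_
      simpa using hlin.inv_tendsto_atTop.const_mul (8 / lam)
    have hlim : Tendsto (fun k : ℕ => ‖whiplash (quarticCost lam xstar) s x₀ k - xstar‖)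
        atTop (𝓝 0) := by
      have := (Real.continuous_sqrt.comp Real.continuous_sqrt).tendsto 0 |>.comp h4
      refine (this.congr fun k => ?_).trans (by simp)
      simp only [Function.comp]
      rw [show ∀ r : ℝ, r ^ 4 = (r ^ 2) ^ 2 from fun r => by ring, Real.sqrt_sq (by positivity),
        Real.sqrt_sq (norm_nonneg _)]
    exact ⟨fun _ => hlim, isBigO_one_div_one_sub_div_rpow lam (hlim.isBigO_one ℝ)⟩
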